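/- Let $R$ be a commutative noetherian ring. A sequence $h_1,\dots,h_r\in R$ is called strongly regular on an $R$-module $M$ if for every $i=1,\dots,r$ the element $h_i$ is a nonzerodivisor on $M/(h_1,\dots,h_{i-1})M$ (it is not required that $M\neq(h_1,\dots,h_r)M$). It is called regular on $M$ if for every prime $\mathfrak p\in\operatorname{Supp}(M/(h_1,\dots,h_r)M)$ the images of $h_1,\dots,h_r$ in $R_{\mathfrak p}$ form a strongly regular sequence on the $R_{\mathfrak p}$-module $M_{\mathfrak p}$; it is called regular in $R$ if it is regular on the $R$-module $R$. For $h_1,\dots,h_r\in R$ let $V(h_1,\dots,h_r)\subseteq\operatorname{Spec}R$ be the set of primes containing all $h_i$. Let $f_1,\dots,f_r,g_1,\dots,g_r\in R$ and let $M$ be a finitely generated $R$-module such that $\operatorname{Supp}(M/(g_1,\dots,g_r)M)\subseteq\operatorname{Supp}(M/(f_1,\dots,f_r)M)$. If $f_1,\dots,f_r$ is a regular sequence on $M$, then $g_1,\dots,g_r$ is also a regular sequence on $M$. In particular, if $V(g_1,\dots,g_r)\subseteq V(f_1,\dots,f_r)$ and $f_1,\dots,f_r$ is a regular sequence in $R$,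 then $g_1,\dots,g_r$ is also a regular sequence in $R$. -/

import Mathlib

/-- A sequence `f₁, …, fᵣ` in `R` is *strongly regular* on the `R`-module `M` if, for every
`i = 1, …, r`, the element `fᵢ` is a nonzerodivisor on `M / (f₁, …, fᵢ₋₁) M`.
It is not required that `M ≠ (f₁, …, fᵣ) M`. -/
def IsStronglyRegularSeq {R : Type*} [CommRing R] (M : Type*) [AddCommGroup M] [Module R M]
    {r : ℕ} (f : Fin r → R) : Prop :=
  RingTheory.Sequence.IsWeaklyRegular M (List.ofFn f)

/-- A sequence `f₁, …, fᵣ` in `R` is *regular* on the `R`-module `M` if, for every prime `p` in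
the support of `M / (f₁, …, fᵣ) M`, the images of `f₁, …, fᵣ` in the local ring `R_p` form a
strongly regular sequence on the `R_p`-module `M_p`. -/
def IsRegularSeq {R : Type*} [CommRing R] (M : Type*) [AddCommGroup M] [Module R M]
    {r : ℕ} (f : Fin r → R) : Prop :=
  ∀ p ∈ Module.support R (M ⧸ (Ideal.span (Set.range f) • ⊤ : Submodule R M)),
    IsStronglyRegularSeq (LocalizedModule p.asIdeal.primeCompl M)
      (fun i => algebraMap R (Localization.AtPrime p.asIdeal) (f i))

/-!
Regularity is tested at a prime `p` in the support of `M / (g) M`. That support is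
`Supp M ∩ V(g)`, so the inclusion of supports says `V(Ann M + (g)) ⊆ V(f)`, that is, every `fᵢ`
lies in the radical of `Ann M + (g)`; this passes to the localization at `p`. The claim thus becomes
one about a nonzero finite module `N` over a noetherian local ring: if some `N`-regular sequence of
length `r` lies in the radical of `Ann N + (g₁, …, gᵣ)`, then `g₁, …, gᵣ` is `N`-regular.

The argument uses depth, in the form of the vanishing of `Ext T N i` for `i < r`, where
`T = N / (g) N`. It holds because `Supp T ⊆ V(f)` and `f` is `N`-regular
(`ModuleCat.subsingleton_ext_of_exists_isRegular`). Conversely, the vanishing makes `g` regular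
(`isWeaklyRegular_of_subsingleton_ext`), by induction on `r` with `T` kept fixed: `Hom(T, N) = 0`
yields an `N`-regular element in `Ann T`, so `(g)` lies in no associated prime of `N`, and by the
coset form of prime avoidance (`Ideal.exists_add_notMem_of_finite`) some
`x ∈ g₁ + (g₂, …, gᵣ)` is `N`-regular. Passing to `N / x N` lowers the range of vanishing by one, so
`x, g₂, …, gᵣ` is regular. Over a local ring regular sequences may be permuted, and the last element
only matters modulo the others, so `x` may be replaced by `g₁`.
-/

universe u v

open RingTheory.Sequence CategoryTheory Abelian Pointwise

/-- Prime avoidance for cosets: if none of finitely many primes contains both `x` and `J`, then some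
element of `x + J` avoids all of them. -/
theorem Ideal.exists_add_notMem_of_finite {R : Type*} [CommRing R] {S : Set (Ideal R)}
    (hS : S.Finite) (hprime : ∀ p ∈ S, p.IsPrime) (x : R) (J : Ideal R)
    (h : ∀ p ∈ S, x ∈ p → ¬ J ≤ p) : ∃ y ∈ J, ∀ p ∈ S, x + y ∉ p := by
  -- It suffices to avoid the maximal elements of `S`. Among these, `y` is chosen inside the primes
  -- that do not contain `x` and outside those that do.
  let T₁ : Set (Ideal R) := {p | Maximal (· ∈ S) p ∧ x ∈ p}
  let T₂ : Set (Ideal R) := {p | Maximal (· ∈ S) p ∧ x ∉ p}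
  have hT₁ : T₁.Finite := hS.subset fun p hp => hp.1.1
  have hT₂ : T₂.Finite := hS.subset fun p hp => hp.1.1
  obtain ⟨y, hy, hyT⟩ : ∃ y ∈ J ⊓ hT₂.toFinset.inf id, ∀ p ∈ T₁, y ∉ p := by
    by_contra! hcon
    have hsub : ((J ⊓ hT₂.toFinset.inf id : Ideal R) : Set R) ⊆
        ⋃ p ∈ T₁, ((id p : Ideal R) : Set R) := by
      intro y hy
      obtain ⟨p, hp, hyp⟩ := hcon y hy
      exact Set.mem_biUnion hp hyp
    obtain ⟨p, hp, hle⟩ := (Ideal.subset_union_prime_finite hT₁ (f := id) ⊥ ⊥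
      fun p hp _ _ => hprime p hp.1.1).1 hsub
    have hpp : p.IsPrime := hprime p hp.1.1
    rcases (hpp.inf_le).1 hle with hJ | hinf
    · exact h p hp.1.1 hp.2 hJ
    · obtain ⟨q, hq, hqp⟩ := (hpp.inf_le').1 hinf
      have hq' : q ∈ T₂ := hT₂.mem_toFinset.1 hq
      exact hq'.2 (hq'.1.eq_of_le hp.1.1 hqp ▸ hp.2)
  refine ⟨y, hy.1, fun p hp hxy => ?_⟩
  obtain ⟨q, hpq, hq⟩ := hS.exists_le_maximal hp
  have hxyq : x + y ∈ q := hpq hxy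
  by_cases hxq : x ∈ q
  · exact hyT q ⟨hq, hxq⟩ ((q.add_mem_iff_right hxq).1 hxyq)
  · have hyq : y ∈ q :=
      Finset.inf_le (f := id) (hT₂.mem_toFinset.2 (show q ∈ T₂ from ⟨hq, hxq⟩)) hy.2
    exact hxq ((q.add_mem_iff_left hyq).1 hxyq)

theorem Ideal.ofList_ofFn {R : Type*} [CommRing R] {r : ℕ} (f : Fin r → R) :
    Ideal.ofList (List.ofFn f) = Ideal.span (Set.range f) :=
  congrArg Ideal.span (Set.ext fun _ => by simp [List.mem_ofFn])

/-- The first element of a regular sequence over a local ring only matters modulo the others. -/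
theorem IsLocalRing.isWeaklyRegular_cons_of_add {A : Type*} [CommRing A] [IsLocalRing A]
    {N : Type*} [AddCommGroup N] [Module A N] [IsNoetherian A N] {a y : A} {as : List A}
    (hmem : ∀ b ∈ a :: as, b ∈ IsLocalRing.maximalIdeal A) (hy : y ∈ Ideal.ofList as)
    (h : IsWeaklyRegular N ((a + y) :: as)) : IsWeaklyRegular N (a :: as) := by
  have hmem' := List.forall_mem_cons.1 hmem
  have hle : Ideal.ofList as ≤ IsLocalRing.maximalIdeal A := Ideal.span_le.2 hmem'.2
  have h₁ := IsLocalRing.isWeaklyRegular_of_perm_of_subset_maximalIdeal h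
    (List.perm_append_singleton (a + y) as).symm
    (List.forall_mem_cons.2 ⟨add_mem hmem'.1 (hle hy), hmem'.2⟩)
  rw [isWeaklyRegular_append_iff, isWeaklyRegular_singleton_iff] at h₁
  have hsmul : ∀ m : N ⧸ (Ideal.ofList as • ⊤ : Submodule A N), (a + y) • m = a • m := by
    intro m
    obtain ⟨n, rfl⟩ := Submodule.mkQ_surjective _ m
    have : y • (Ideal.ofList as • ⊤ : Submodule A N).mkQ n = 0 := by
      rw [← map_smul]
      exact (Submodule.Quotient.mk_eq_zero _).2 (Submodule.smul_mem_smul hy trivial)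
    rw [add_smul, this, add_zero]
  have h₂ : IsWeaklyRegular N (as ++ [a]) := by
    rw [isWeaklyRegular_append_iff, isWeaklyRegular_singleton_iff]
    refine ⟨h₁.1, fun m n hmn => h₁.2 ?_⟩
    simpa only [hsmul] using hmn
  refine IsLocalRing.isWeaklyRegular_of_perm_of_subset_maximalIdeal h₂
    (List.perm_append_singleton a as) fun b hb => hmem b ?_
  exact (List.perm_append_singleton a as).mem_iff.1 hb

/-- If the radical of `(g) + J + Ann N` contains an `N`-regular element, then so does the coset
`g + J`. -/
theorem IsSMulRegular.exists_add_of_mem_radical {A : Type*} [CommRing A] [IsNoetherianRing A]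
    {N : Type*} [AddCommGroup N] [Module A N] [Module.Finite A N] {a g : A} {J : Ideal A}
    (ha : a ∈ (Ideal.span {g} ⊔ J ⊔ Module.annihilator A N).radical) (hreg : IsSMulRegular N a) :
    ∃ y ∈ J, IsSMulRegular N (g + y) := by
  have hcompl := biUnion_associatedPrimes_eq_compl_regular A (M := N)
  obtain ⟨y, hy, hyp⟩ := Ideal.exists_add_notMem_of_finite (associatedPrimes.finite A N)
    (fun p hp => hp.isPrime) g J fun p hp hg hle => by
      have hNp : Module.annihilator A N ≤ p :=
        Submodule.annihilator_top (R := A) (M := N) ▸ hp.annihilator_le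
      have hap : a ∈ p := (hp.isPrime.radical_le_iff.2
        (sup_le (sup_le ((Ideal.span_singleton_le_iff_mem p).2 hg) hle) hNp)) ha
      have : a ∈ {r : A | IsSMulRegular N r}ᶜ := hcompl ▸ Set.mem_biUnion hp hap
      exact this hreg
  refine ⟨y, hy, ?_⟩
  by_contra hn
  have : g + y ∈ ⋃ p ∈ associatedPrimes A N, (p : Set A) := hcompl ▸ hn
  obtain ⟨p, hp, hmemp⟩ := Set.mem_iUnion₂.1 this
  exact hyp p hp hmemp

/-- If `Ext T N i` vanishes for `i` below the length of `gs`, then `gs` is regular on `N`, as soon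
as `Ann T` lies in the radical of `(gs) + Ann N`. The case of interest is `T = N / (gs) N`, but the
induction replaces `N` and `gs` while `T` stays the same. -/
theorem isWeaklyRegular_of_subsingleton_ext {A : Type u} [CommRing A] [IsNoetherianRing A]
    [IsLocalRing A] [Small.{v} A] (T : ModuleCat.{v} A) [Module.Finite A T] (gs : List A)
    (N : ModuleCat.{v} A) [Module.Finite A N]
    (hmem : ∀ a ∈ gs, a ∈ IsLocalRing.maximalIdeal A)
    (hann : Module.annihilator A T ≤ (Ideal.ofList gs ⊔ Module.annihilator A N).radical)
    (hext : ∀ i < gs.length, Subsingleton (Ext T N i)) : IsWeaklyRegular N gs := by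
  induction gs generalizing N with
  | nil => exact .nil A N
  | cons g gs ih =>
    have : Subsingleton (T ⟶ N) := Ext.addEquiv₀.subsingleton_congr.mp (hext 0 (by simp))
    have : Subsingleton (T →ₗ[A] N) := ModuleCat.homAddEquiv.symm.subsingleton
    obtain ⟨a, haT, haN⟩ := IsSMulRegular.subsingleton_linearMap_iff.mp this
    rw [Ideal.ofList_cons] at hann
    obtain ⟨y, hy, hreg⟩ := IsSMulRegular.exists_add_of_mem_radical (hann haT) haN
    refine IsLocalRing.isWeaklyRegular_cons_of_add hmem hy
      ((isWeaklyRegular_cons_iff _ _ _).2 ⟨hreg, ?_⟩)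
    refine ih (ModuleCat.of A (QuotSMulTop (g + y) N))
      (fun b hb => hmem b (List.mem_cons_of_mem _ hb)) ?_ fun i hi => ?_
    · refine hann.trans (Ideal.radical_mono (sup_le ?_ ?_))
      · -- `g = (g + y) - y`, and `g + y` annihilates the quotient.
        refine sup_le ((Ideal.span_singleton_le_iff_mem _).2 ?_) le_sup_left
        have hgy : g + y ∈ Module.annihilator A (QuotSMulTop (g + y) N) := by
          refine Module.mem_annihilator.2 fun m => ?_
          obtain ⟨n, rfl⟩ := Submodule.mkQ_surjective _ m
          rw [← map_smul]
          exact (Submodule.Quotient.mk_eq_zero _).2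
            (Submodule.smul_mem_pointwise_smul _ _ _ trivial)
        have := sub_mem (Ideal.mem_sup_right hgy)
          (Ideal.mem_sup_left (T := Module.annihilator A (QuotSMulTop (g + y) N)) hy)
        simpa using this
      · exact le_trans (LinearMap.annihilator_le_of_surjective _ (Submodule.mkQ_surjective _))
          le_sup_right
    · have zero₁ := AddCommGrpCat.isZero_of_iff_subsingleton.mpr (hext i (by simp; omega))
      have zero₂ := AddCommGrpCat.isZero_of_iff_subsingleton.mpr (hext (i + 1) (by simpa using hi))
      exact AddCommGrpCat.subsingleton_of_isZero <| ShortComplex.Exact.isZero_of_both_zeros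
        ((Ext.covariant_sequence_exact₃' T hreg.smulShortComplex_shortExact) i (i + 1) rfl)
        (zero₁.eq_zero_of_src _) (zero₂.eq_zero_of_tgt _)

/-- Over a noetherian local ring, if a regular sequence on `N` lies in the radical of
`(gs) + Ann N` and `gs` has the same length, then `gs` is regular on `N`. -/
theorem IsLocalRing.isWeaklyRegular_of_ofList_le_radical {A : Type u} [CommRing A]
    [IsNoetherianRing A] [IsLocalRing A] {N : Type (max u v)} [AddCommGroup N] [Module A N]
    [Module.Finite A N] [Nontrivial N] {fs gs : List A} (hlen : fs.length = gs.length)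
    (hf : ∀ a ∈ fs, a ∈ IsLocalRing.maximalIdeal A) (hg : ∀ a ∈ gs, a ∈ IsLocalRing.maximalIdeal A)
    (hle : Ideal.ofList fs ≤ (Ideal.ofList gs ⊔ Module.annihilator A N).radical)
    (hreg : IsWeaklyRegular N fs) : IsWeaklyRegular N gs := by
  let T : ModuleCat.{max u v} A := ModuleCat.of A (N ⧸ (Ideal.ofList gs • ⊤ : Submodule A N))
  have hT : Module.support A T =
      PrimeSpectrum.zeroLocus (Ideal.ofList gs ⊔ Module.annihilator A N : Ideal A) := by
    rw [Module.support_quotient, Module.support_eq_zeroLocus, PrimeSpectrum.zeroLocus_sup,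
      Set.inter_comm]
  have hfreg : IsRegular N fs := .of_isWeaklyRegular_of_mem_maximalIdeal N hf hreg
  refine isWeaklyRegular_of_subsingleton_ext T gs (ModuleCat.of A N) hg ?_ fun i hi => ?_
  · rw [Module.support_eq_zeroLocus, PrimeSpectrum.zeroLocus_eq_iff] at hT
    exact hT ▸ Ideal.le_radical
  · refine ModuleCat.subsingleton_ext_of_exists_isRegular (Ideal.ofList fs) T ?_ (ModuleCat.of A N)
      (lt_top_iff_ne_top.2 hfreg.top_ne_smul.symm) fs (fun a ha => Ideal.subset_span ha) hfreg i
      (hlen ▸ hi)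
    rw [hT]
    exact PrimeSpectrum.zeroLocus_subset_zeroLocus_iff _ _ |>.2 hle

/-- The annihilator of a module maps into the annihilator of its localization. -/
theorem LocalizedModule.map_annihilator_le {R : Type*} [CommRing R] (S : Submonoid R) (M : Type*)
    [AddCommGroup M] [Module R M] :
    (Module.annihilator R M).map (algebraMap R (Localization S)) ≤
      Module.annihilator (Localization S) (LocalizedModule S M) := by
  refine Ideal.map_le_iff_le_comap.2 fun a ha => Module.mem_annihilator.2 fun m => ?_
  rw [algebraMap_smul]
  induction m with
  | h m s => rw [LocalizedModule.smul'_mk, Module.mem_annihilator.1 ha, LocalizedModule.zero_mk]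

theorem IsRegularSeq.of_support_subset {R : Type u} [CommRing R] [IsNoetherianRing R] {r : ℕ}
    {f g : Fin r → R} (M : Type v) [AddCommGroup M] [Module R M] [Module.Finite R M]
    (h : Module.support R (M ⧸ (Ideal.span (Set.range g) • ⊤ : Submodule R M)) ⊆
      Module.support R (M ⧸ (Ideal.span (Set.range f) • ⊤ : Submodule R M)))
    (hf : IsRegularSeq M f) : IsRegularSeq M g := by
  intro p hp
  have hreg := hf p (h hp)
  have hpf := h hp
  rw [Module.support_quotient] at hp hpf
  have hrad : Ideal.span (Set.range f) ≤
      (Ideal.span (Set.range g) ⊔ Module.annihilator R M).radical := by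
    rw [← PrimeSpectrum.zeroLocus_subset_zeroLocus_iff, PrimeSpectrum.zeroLocus_sup,
      ← Module.support_eq_zeroLocus, Set.inter_comm, ← Module.support_quotient]
    exact h.trans (by rw [Module.support_quotient]; exact Set.inter_subset_right)
  have : Nontrivial (LocalizedModule p.asIdeal.primeCompl M) := hp.1
  have hmax : ∀ {k : Fin r → R}, Ideal.span (Set.range k) ≤ p.asIdeal →
      ∀ a ∈ List.ofFn fun i => algebraMap R (Localization.AtPrime p.asIdeal) (k i),
        a ∈ IsLocalRing.maximalIdeal (Localization.AtPrime p.asIdeal) := by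
    intro k hk a ha
    obtain ⟨i, rfl⟩ := List.mem_ofFn.1 ha
    exact (IsLocalization.AtPrime.to_map_mem_maximal_iff _ p.asIdeal _).2
      (hk (Ideal.subset_span ⟨i, rfl⟩))
  have hmap : ∀ k : Fin r → R,
      Ideal.ofList (List.ofFn fun i => algebraMap R (Localization.AtPrime p.asIdeal) (k i)) =
        (Ideal.span (Set.range k)).map (algebraMap R (Localization.AtPrime p.asIdeal)) := by
    intro k
    rw [Ideal.ofList_ofFn, Ideal.map_span, ← Set.range_comp]
    rfl
  refine IsLocalRing.isWeaklyRegular_of_ofList_le_radical.{u, v} (by simp) (hmax hpf.2) (hmax hp.2)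
    ?_ hreg
  rw [hmap, hmap]
  refine (Ideal.map_mono hrad).trans ((Ideal.map_radical_le _).trans (Ideal.radical_mono ?_))
  rw [Ideal.map_sup]
  exact sup_le_sup_left (LocalizedModule.map_annihilator_le _ M) _

theorem corollary2 {R : Type*} [CommRing R] [IsNoetherianRing R] {r : ℕ}
    (f g : Fin r → R) :
    (∀ (M : Type*) [AddCommGroup M] [Module R M] [Module.Finite R M],
      Module.support R (M ⧸ (Ideal.span (Set.range g) • ⊤ : Submodule R M)) ⊆
        Module.support R (M ⧸ (Ideal.span (Set.range f) • ⊤ : Submodule R M)) →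
      IsRegularSeq M f → IsRegularSeq M g) ∧
    (PrimeSpectrum.zeroLocus (Set.range g) ⊆ PrimeSpectrum.zeroLocus (Set.range f) →
      IsRegularSeq R f → IsRegularSeq R g) := by
  refine ⟨fun M _ _ _ => IsRegularSeq.of_support_subset M, fun h =>
    IsRegularSeq.of_support_subset R ?_⟩
  rw [Module.support_quotient, Module.support_quotient, PrimeSpectrum.zeroLocus_span,
    PrimeSpectrum.zeroLocus_span]
  exact Set.inter_subset_inter_right _ h
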